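/- Let $\mathrm{Top}$ be the category of topological spaces and let $\mathrm{Hom}^{c}(\mathrm{Top},\mathrm{Top})$ be the category of functors $\mathrm{Top}\to\mathrm{Top}$ preserving all small limits, with all natural transformations as morphisms. A *topological frame* is a frame $F$ with a topology such that the maps $\bigvee : F^I\to F$ and $\bigwedge : F^J\to F$ are continuous for every set $I$ and every finite set $J$ (powers carry the product topology); morphisms are continuous frame homomorphisms. A *topological complete atomic Boolean algebra* is a complete atomic Boolean algebra with a topology which makes it a topological frame with continuous complementation; morphisms are continuous homomorphisms of complete Boolean algebras. Let $U$ denote the forgetful functor from topological complete atomic Boolean algebras to topological frames. A *topological topology* $(X,\tau)$ is a topological space $X$ with a topology $\tau$ on its set $\mathcal O(X)$ of open subsets such that $\bigcup:\mathcal O(X)^I\to\mathcal O(X)$ and $\bigcap:\mathcal O(X)^J\to\mathcal O(X)$ are continuous with respect to $\tau$ for every set $I$ and every finite set $J$. A morphism $(X,\tau)\to(Y,\sigma)$ is a continuous map $f:X\to Y$ such that $f^*:(\mathcal O(Y),\sigma)\to(\mathcal O(X),\tau)$, $V\mapsto f^{-1}(V)$, is continuous. Let $\mathrm{Top}'$ be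 the resulting category. A *frame-based topological space object in* $\mathrm{Top}$ is a triple $(F,B,\psi)$ with $F$ a topological frame, $B$ a topological complete atomic Boolean algebra and $\psi:F\hookrightarrow U(B)$ a monomorphism of topological frames. A morphism $(F,B,\psi)\to(F',B',\psi')$ is a pair of morphisms $F'\to F$, $B'\to B$ making the evident square commute. Let $\overline{\mathrm{Top}}(\mathrm{Top})$ be the resulting category. **Theorem.** 1. There is an equivalence of categories $\mathrm{Hom}^{c}(\mathrm{Top},\mathrm{Top})\simeq(\mathrm{Top}')^{\mathrm{op}}$. 2. Every topological complete atomic Boolean algebra is isomorphic, as a topological complete atomic Boolean algebra, to the power set $P(X)$ of some set $X$ with the indiscrete topology. 3. The functor $\mathrm{Top}'\to\overline{\mathrm{Top}}(\mathrm{Top})$ sending $(X,\tau)$ to the inclusion $(\mathcal O(X),\tau)\hookrightarrow P(X)$, where $P(X)$ carries the indiscrete topology, and a morphism $f$ to the pair of preimage maps of $f$, is an equivalence of categories. -/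

import Mathlib

open CategoryTheory CategoryTheory.Limits TopologicalSpace Topology

universe u

/-! ### Continuous endofunctors of the category of topological spaces -/

/-- The category of continuous (that is, small-limit preserving) endofunctors of the category of
topological spaces, as a full subcategory of the functor category: morphisms are all natural
transformations. -/
abbrev ContinuousEndofunctor : Type (u + 1) :=
  ObjectProperty.FullSubcategory
    (fun F : TopCat.{u} ⥤ TopCat.{u} => PreservesLimitsOfSize.{u, u} F)

/-! ### Topological frames -/

/-- A topology on a frame makes it a topological frame when all small joins and all finite meets
are continuous, where powers carry the product topology. -/
structure IsTopologicalFrame (F : Type u) [Order.Frame F] [TopologicalSpace F] : Prop where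
  continuous_iSup : ∀ I : Type u, Continuous (fun a : I → F => ⨆ i, a i)
  continuous_iInf : ∀ (J : Type u) [Finite J], Continuous (fun a : J → F => ⨅ j, a j)

/-- Topological frames, that is, internal frames in the category of topological spaces. -/
structure TopFrame : Type (u + 1) where
  carrier : Type u
  [frame : Order.Frame carrier]
  [top : TopologicalSpace carrier]
  isTopological : IsTopologicalFrame carrier

namespace TopFrame

attribute [instance] TopFrame.frame TopFrame.top

/-- Morphisms of topological frames are the continuous frame homomorphisms. -/
@[ext]
structure Hom (F G : TopFrame.{u}) : Type u where
  toFrameHom : FrameHom F.carrier G.carrier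
  continuous : Continuous toFrameHom

instance : Category TopFrame.{u} where
  Hom F G := Hom F G
  id F := ⟨FrameHom.id F.carrier, continuous_id⟩
  comp f g := ⟨g.toFrameHom.comp f.toFrameHom, g.continuous.comp f.continuous⟩

end TopFrame

/-! ### Topological complete atomic Boolean algebras -/

/-- Topological complete atomic Boolean algebras, that is, internal complete atomic Boolean
algebras in the category of topological spaces: small joins, finite meets and complementation are
continuous. -/
structure TopCABA : Type (u + 1) where
  carrier : Type u
  [caba : CompleteAtomicBooleanAlgebra carrier]
  [top : TopologicalSpace carrier]
  isTopological : IsTopologicalFrame carrier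
  continuous_compl : Continuous (fun a : carrier => aᶜ)

namespace TopCABA

attribute [instance] TopCABA.caba TopCABA.top

/-- Morphisms of topological complete atomic Boolean algebras are the continuous maps preserving
all joins and meets (and therefore complements). -/
@[ext]
structure Hom (A B : TopCABA.{u}) : Type u where
  toCompleteLatticeHom : CompleteLatticeHom A.carrier B.carrier
  continuous : Continuous toCompleteLatticeHom

instance : Category TopCABA.{u} where
  Hom A B := Hom A B
  id A := ⟨CompleteLatticeHom.id A.carrier, continuous_id⟩
  comp f g := ⟨g.toCompleteLatticeHom.comp f.toCompleteLatticeHom,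
    g.continuous.comp f.continuous⟩

/-- The underlying topological frame of a topological complete atomic Boolean algebra. -/
def toTopFrame : TopCABA.{u} ⥤ TopFrame.{u} where
  obj B := { carrier := B.carrier, isTopological := B.isTopological }
  map f := TopFrame.Hom.mk
    { toFun := f.toCompleteLatticeHom
      map_inf' := map_inf f.toCompleteLatticeHom
      map_top' := map_top f.toCompleteLatticeHom
      map_sSup' := map_sSup f.toCompleteLatticeHom } f.continuous

/-- The power set of `X`, equipped with the indiscrete topology. -/
def powerset (X : Type u) : TopCABA.{u} :=
  letI : TopologicalSpace (Set X) := ⊤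
  { carrier := Set X
    isTopological := ⟨fun _ => continuous_top, fun _ _ => continuous_top⟩
    continuous_compl := continuous_top }

/-- The preimage map between power sets. -/
def powersetMap {X Y : Type u} (f : X → Y) : powerset Y ⟶ powerset X :=
  Hom.mk (CompleteLatticeHom.setPreimage f) continuous_top

end TopCABA

/-! ### Topological topologies -/

/-- A topological topology: a topological space `X` together with a topology on its lattice of
open sets for which arbitrary small unions and finite intersections are continuous. (In `Opens X`
joins are unions and finite meets are intersections.) -/
structure TopTopology : Type (u + 1) where
  space : TopCat.{u}
  opensTop : TopologicalSpace (Opens space)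
  isTopological : @IsTopologicalFrame (Opens space) _ opensTop

namespace TopTopology

/-- A morphism of topological topologies is a continuous map for which the preimage map between
the lattices of open sets is continuous as well. -/
@[ext]
structure Hom (X Y : TopTopology.{u}) : Type u where
  map : X.space ⟶ Y.space
  continuous_comap : Continuous[Y.opensTop, X.opensTop] (Opens.comap map.hom)

instance : Category TopTopology.{u} where
  Hom X Y := Hom X Y
  id X := ⟨𝟙 X.space, @continuous_id _ X.opensTop⟩
  comp {X Y Z} f g := ⟨f.map ≫ g.map,
    @Continuous.comp _ _ _ Z.opensTop Y.opensTop X.opensTop _ _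
      f.continuous_comap g.continuous_comap⟩

/-- The topological frame of open sets of a topological topology. -/
def opens (X : TopTopology.{u}) : TopFrame.{u} :=
  @TopFrame.mk (Opens X.space) _ X.opensTop X.isTopological

/-- The inclusion of the open sets of a space into its power set, as a frame homomorphism. -/
def coeHom (X : TopCat.{u}) : FrameHom (Opens X) (Set X) where
  toFun U := (U : Set X)
  map_inf' _ _ := rfl
  map_top' := rfl
  map_sSup' s := by rw [Opens.coe_sSup, sSup_image]; rfl

/-- The inclusion of the topological frame of open sets into the indiscrete power set. -/
def inclusion (X : TopTopology.{u}) :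
    X.opens ⟶ TopCABA.toTopFrame.obj (TopCABA.powerset X.space) :=
  TopFrame.Hom.mk (F := X.opens) (G := TopCABA.toTopFrame.obj (TopCABA.powerset X.space))
    (coeHom X.space) continuous_top

theorem mono_inclusion (X : TopTopology.{u}) : Mono X.inclusion where
  right_cancellation {F} g h w := by
    refine TopFrame.Hom.ext (DFunLike.ext _ _ fun a => ?_)
    have e := DFunLike.congr_fun (congrArg TopFrame.Hom.toFrameHom w) a
    exact SetLike.coe_injective (A := Opens X.space) e

end TopTopology

/-! ### Frame-based topological space objects internal to topological spaces -/

/-- The opposite of the category of frame-based topological space objects internal to topological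
spaces: the full subcategory of the comma category `id ↓ U` on the triples `(F, B, ψ)` for which
`ψ : F ⟶ U B` is a monomorphism of topological frames. -/
abbrev FrameSpaceOp : Type (u + 1) :=
  ObjectProperty.FullSubcategory
    (fun T : Comma (𝟭 TopFrame.{u}) TopCABA.toTopFrame.{u} => Mono T.hom)

/-- The category of frame-based topological space objects internal to topological spaces: a
morphism `(F, B, ψ) ⟶ (F', B', ψ')` is a commutative square with sides `F' ⟶ F` and
`B' ⟶ B`. -/
abbrev FrameSpace : Type (u + 1) := FrameSpaceOp.{u}ᵒᵖ

/-- The functor from topological topologies to frame-based topological space objects which sends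
`X` with a topology on its lattice of open sets to the inclusion of that lattice into the
indiscrete power set of `X`, and a morphism to its preimage maps. -/
def TopTopology.toFrameSpace : TopTopology.{u} ⥤ FrameSpace.{u} where
  obj X := Opposite.op
    { obj := { left := X.opens, right := TopCABA.powerset X.space, hom := X.inclusion }
      property := X.mono_inclusion }
  map {X Y} f := Quiver.Hom.op (ObjectProperty.homMk
    { left := TopFrame.Hom.mk (F := Y.opens) (G := X.opens)
        (Opens.comap f.map.hom) f.continuous_comap
      right := TopCABA.powersetMap f.map.hom
      w := TopFrame.Hom.ext (DFunLike.ext _ _ fun _ => rfl) })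

namespace IsTopologicalFrame

variable {F : Type u} [Order.Frame F] [TopologicalSpace F] {Z : Type*} [TopologicalSpace Z]

theorem iSup_comp (hF : IsTopologicalFrame F) {I : Type u} {f : I → Z → F}
    (hf : ∀ i, Continuous (f i)) : Continuous fun z => ⨆ i, f i z :=
  (hF.continuous_iSup I).comp (continuous_pi hf)

theorem inf_comp (hF : IsTopologicalFrame F) {f g : Z → F} (hf : Continuous f)
    (hg : Continuous g) : Continuous fun z => f z ⊓ g z := by
  have h : Continuous fun z (b : ULift.{u} Bool) => cond b.down (f z) (g z) :=
    continuous_pi fun b => by rcases b with ⟨_ | _⟩ <;> assumption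
  refine ((hF.continuous_iInf (ULift.{u} Bool)).comp h).congr fun z => ?_
  simp [iInf_ulift, iInf_bool_eq]

/-- Open subsets of a topological frame are upper sets. -/
theorem isUpperSet (hF : IsTopologicalFrame F) {W : Set F} (hW : IsOpen W) : IsUpperSet W := by
  intro a b hab ha
  have hV := hW.preimage (hF.continuous_iSup (ULift.{u} ℕ))
  obtain ⟨I, v, hv, hsub⟩ := isOpen_pi_iff.1 hV (fun _ => a) (by simpa using ha)
  obtain ⟨n, hn⟩ := Infinite.exists_notMem_finset I
  classical
  have hmem : Function.update (fun _ : ULift.{u} ℕ => a) n b ∈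
      (fun a : ULift.{u} ℕ → F => ⨆ i, a i) ⁻¹' W := by
    refine hsub fun i hi => ?_
    rw [Function.update_of_ne (by rintro rfl; exact hn hi)]
    exact (hv i hi).2
  have hsup : ⨆ i, Function.update (fun _ : ULift.{u} ℕ => a) n b i = b := by
    refine le_antisymm (iSup_le fun i => ?_) (le_iSup_of_le n (by simp))
    by_cases h : i = n <;> simp [h, hab, Function.update_of_ne]
  rwa [Set.mem_preimage, hsup] at hmem

/-- A frame whose topology is induced by a frame homomorphism to a topological frame is a
topological frame. -/
theorem induced {G : Type u} [Order.Frame G] (hF : IsTopologicalFrame F) (φ : FrameHom G F) :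
    @IsTopologicalFrame G _ (.induced φ ‹_›) :=
  letI : TopologicalSpace G := .induced φ ‹_›
  { continuous_iSup I := continuous_induced_rng.2 <| by
      refine (hF.iSup_comp (f := fun i (a : I → G) => φ (a i)) fun i =>
        continuous_induced_dom.comp (continuous_apply i)).congr fun a => ?_
      exact (map_iSup φ a).symm
    continuous_iInf J _ := continuous_induced_rng.2 <| by
      have h : Continuous fun (a : J → G) j => φ (a j) :=
        continuous_pi fun j => continuous_induced_dom.comp (continuous_apply j)
      refine ((hF.continuous_iInf J).comp h).congr fun a => ?_
      have := Fintype.ofFinite J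
      simp only [Function.comp, ← Finset.inf_univ_eq_iInf]
      exact (map_finset_inf φ Finset.univ a).symm }

end IsTopologicalFrame

namespace TopCABA

/-- A topological complete atomic Boolean algebra is indiscrete. -/
theorem top_eq_top (B : TopCABA.{u}) : B.top = ⊤ := by
  refine top_unique fun W hW => ?_
  rw [isOpen_top_iff]
  rcases W.eq_empty_or_nonempty with h | ⟨a, ha⟩
  · exact .inl h
  · have htop : ⊤ ∈ W := B.isTopological.isUpperSet hW le_top ha
    have hbot : (⊥ : B.carrier) ∈ W := by
      simpa using B.isTopological.isUpperSet (hW.preimage B.continuous_compl) (le_top (a := ⊥))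
        (by simpa using htop)
    exact .inr (Set.eq_univ_of_forall fun b => B.isTopological.isUpperSet hW bot_le hbot)

theorem continuous_of_any {A B : TopCABA.{u}} (f : A.carrier → B.carrier) : Continuous f := by
  rw [continuous_iff_coinduced_le, B.top_eq_top]
  exact le_top

/-- An order isomorphism of topological complete atomic Boolean algebras is an isomorphism. -/
def isoOfOrderIso {A B : TopCABA.{u}} (e : A.carrier ≃o B.carrier) : A ≅ B where
  hom := Hom.mk (e : CompleteLatticeHom A.carrier B.carrier) (continuous_of_any _)
  inv := Hom.mk (e.symm : CompleteLatticeHom B.carrier A.carrier) (continuous_of_any _)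
  hom_inv_id := Hom.ext (DFunLike.ext _ _ e.symm_apply_apply)
  inv_hom_id := Hom.ext (DFunLike.ext _ _ e.apply_symm_apply)

theorem exists_iso_powerset (B : TopCABA.{u}) : ∃ X : Type u, Nonempty (B ≅ powerset X) :=
  ⟨_, ⟨isoOfOrderIso (B := powerset {a : B.carrier // IsAtom a})
    CompleteAtomicBooleanAlgebra.toSetOfIsAtom⟩⟩

end TopCABA

theorem CompleteLatticeHom.exists_eq_setPreimage {X Y : Type*}
    (β : CompleteLatticeHom (Set Y) (Set X)) :
    ∃ f : X → Y, β = CompleteLatticeHom.setPreimage f := by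
  have hex (x : X) : ∃ y, x ∈ β {y} := by
    have h : β (⨆ y, {y}) = Set.univ := by
      rw [Set.iSup_eq_iUnion, Set.iUnion_of_singleton]; exact map_top β
    rw [map_iSup] at h
    simpa using h.ge (Set.mem_univ x)
  choose f hf using hex
  refine ⟨f, DFunLike.ext _ _ fun s => Set.ext fun x => ⟨fun hx => ?_, fun hx => ?_⟩⟩
  · by_contra hs
    have h : x ∈ β (s ⊓ {f x}) := by rw [map_inf]; exact ⟨hx, hf x⟩
    have h0 : s ⊓ {f x} = (⊥ : Set Y) := Set.inter_singleton_eq_empty.2 hs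
    rw [h0, map_bot] at h
    exact h
  · have h : ({f x} : Set Y) ≤ s := Set.singleton_subset_iff.2 hx
    exact OrderHomClass.mono β h (hf x)

namespace TopologicalSpace.Opens

variable (X : Type u) [TopologicalSpace X]

/-- The topology of pointwise convergence on the lattice of open sets, with respect to the
Sierpiński topology on truth values. -/
abbrev pointwiseTopology : TopologicalSpace (Opens X) :=
  .induced (fun U x => x ∈ U) (inferInstance : TopologicalSpace (X → Prop))

theorem continuous_pointwise_iff {Z : Type*} [TopologicalSpace Z] {f : Z → Opens X} :
    Continuous[_, pointwiseTopology X] f ↔ ∀ x, IsOpen {z | x ∈ f z} := by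
  rw [continuous_induced_rng, continuous_pi_iff]
  exact forall_congr' fun x => continuous_Prop

theorem isTopologicalFrame_pointwise : @IsTopologicalFrame (Opens X) _ (pointwiseTopology X) := by
  let _ := pointwiseTopology X
  have hx (x : X) : Continuous fun U : Opens X => x ∈ U :=
    continuous_Prop.2 ((continuous_pointwise_iff X).1 continuous_id x)
  refine ⟨fun I => (continuous_pointwise_iff X).2 fun x => ?_,
    fun J _ => (continuous_pointwise_iff X).2 fun x => ?_⟩
  · have h : {a : I → Opens X | x ∈ ⨆ i, a i} = ⋃ i, {a | x ∈ a i} := by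
      ext a
      simp
    rw [h]
    exact isOpen_iUnion fun i => continuous_Prop.1 ((hx x).comp (continuous_apply i))
  · have h : {a : J → Opens X | x ∈ ⨅ j, a j} = ⋂ j, {a | x ∈ a j} := by
      ext a
      rw [Set.mem_ofPred_eq, ← SetLike.mem_coe, coe_iInf]
      simp
    rw [h]
    exact isOpen_iInter_of_finite fun i => continuous_Prop.1 ((hx x).comp (continuous_apply i))

end TopologicalSpace.Opens

/-- The Sierpiński space. -/
abbrev Sierpinski : Type u := ULift.{u} Prop

namespace Sierpinski

/-- The open set of true values. -/
def openTrue : Opens Sierpinski.{u} :=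
  ⟨{p | p.down}, continuous_Prop.1 continuous_uliftDown⟩

theorem mem_of_mem {U : Opens Sierpinski.{u}} (h : ⟨False⟩ ∈ U) : ⟨True⟩ ∈ U := by
  have hs : (⟨True⟩ : Sierpinski.{u}) ⤳ ⟨False⟩ :=
    IsEmbedding.uliftDown.isInducing.specializes_iff.1
      (specializes_iff_pure.2 (by simp [nhds_false]))
  exact hs.mem_open U.isOpen h

/-- The frame homomorphism from the open sets of the Sierpiński space, which form the free frame
on one generator, determined by an element `a`. -/
def frameHom {F : Type u} [Order.Frame F] (a : F) : FrameHom (Opens Sierpinski.{u}) F where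
  toFun U := (⨆ _ : ⟨True⟩ ∈ U, a) ⊔ ⨆ _ : ⟨False⟩ ∈ U, ⊤
  map_inf' U V := by
    have hU := @mem_of_mem U
    have hV := @mem_of_mem V
    by_cases h1 : (⟨True⟩ : Sierpinski.{u}) ∈ U <;> by_cases h2 : (⟨True⟩ : Sierpinski.{u}) ∈ V <;>
    by_cases h3 : (⟨False⟩ : Sierpinski.{u}) ∈ U <;>
    by_cases h4 : (⟨False⟩ : Sierpinski.{u}) ∈ V <;> simp_all
  map_top' := by simp
  map_sSup' s := by
    simp only [Opens.mem_sSup, sSup_image, iSup_exists, iSup_and, iSup_sup_eq]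
    
theorem continuous_frameHom {F : Type u} [Order.Frame F] [TopologicalSpace F]
    (hF : IsTopologicalFrame F) (a : F) :
    Continuous[Opens.pointwiseTopology Sierpinski.{u}, _] (frameHom a) := by
  let _ := Opens.pointwiseTopology Sierpinski.{u}
  refine continuous_def.2 fun W hW => ?_
  have hx (x : Sierpinski.{u}) : IsOpen {U : Opens Sierpinski.{u} | x ∈ U} :=
    (Opens.continuous_pointwise_iff _).1 continuous_id x
  refine isOpen_iff_forall_mem_open.2 fun U hU => ?_
  refine ⟨{V | ⟨True⟩ ∈ U → ⟨True⟩ ∈ V} ∩ {V | ⟨False⟩ ∈ U → ⟨False⟩ ∈ V}, fun V hV => ?_,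
    IsOpen.inter ?_ ?_, id, id⟩
  · refine hF.isUpperSet hW ?_ hU
    exact sup_le_sup (iSup_mono' fun h => ⟨hV.1 h, le_rfl⟩)
      (iSup_mono' fun h => ⟨hV.2 h, le_rfl⟩)
  · by_cases h : ⟨True⟩ ∈ U
    · simpa [h] using hx _
    · simp [h]
  · by_cases h : ⟨False⟩ ∈ U
    · simpa [h] using hx _
    · simp [h]

end Sierpinski

namespace TopFrame

/-- The topological frame of open sets of the Sierpiński space. -/
def sierpinski : TopFrame.{u} :=
  @TopFrame.mk (Opens Sierpinski.{u}) _ (Opens.pointwiseTopology _)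
    (Opens.isTopologicalFrame_pointwise _)

/-- The morphism of topological frames from the open sets of the Sierpiński space determined by
an element. -/
def homOfElement (F : TopFrame.{u}) (a : F.carrier) : sierpinski ⟶ F :=
  Hom.mk (F := sierpinski) (Sierpinski.frameHom a)
    (Sierpinski.continuous_frameHom F.isTopological a)

theorem homOfElement_openTrue (F : TopFrame.{u}) (a : F.carrier) :
    (F.homOfElement a).toFrameHom Sierpinski.openTrue = a := by
  change (⨆ _ : _, a) ⊔ (⨆ _ : _, ⊤) = a
  simp [Sierpinski.openTrue, ← SetLike.mem_coe]

theorem injective_of_mono {F G : TopFrame.{u}} (ψ : F ⟶ G) [Mono ψ] :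
    Function.Injective ψ.toFrameHom := by
  intro a b hab
  have h : F.homOfElement a ≫ ψ = F.homOfElement b ≫ ψ := by
    refine Hom.ext (DFunLike.ext _ _ fun U => ?_)
    change ψ.toFrameHom ((⨆ _ : _, a) ⊔ _) = ψ.toFrameHom ((⨆ _ : _, b) ⊔ _)
    simp only [map_sup, map_iSup, hab]
  rw [← F.homOfElement_openTrue a, (cancel_mono ψ).1 h, homOfElement_openTrue]

end TopFrame

namespace TopFrame

/-- An order isomorphism which induces the topology is an isomorphism of topological frames. -/
def isoOfOrderIso {F G : TopFrame.{u}} (e : F.carrier ≃o G.carrier) (he : IsInducing e) :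
    F ≅ G where
  hom := Hom.mk (e : FrameHom F.carrier G.carrier) he.continuous
  inv := Hom.mk (e.symm : FrameHom G.carrier F.carrier) <| he.continuous_iff.2 <|
    continuous_id.congr fun a => (e.apply_symm_apply a).symm
  hom_inv_id := Hom.ext (DFunLike.ext _ _ e.symm_apply_apply)
  inv_hom_id := Hom.ext (DFunLike.ext _ _ e.apply_symm_apply)

end TopFrame

namespace TopTopology

instance : toFrameSpace.{u}.Faithful where
  map_injective {X Y f g} h := by
    have h' : TopCABA.powersetMap f.map.hom = TopCABA.powersetMap g.map.hom :=
      congrArg (fun k => k.unop.hom.right) h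
    refine Hom.ext (TopCat.hom_ext (ContinuousMap.ext fun x => ?_))
    have hx := DFunLike.congr_fun (congrArg TopCABA.Hom.toCompleteLatticeHom h')
      ({g.map.hom x} : Set Y.space)
    exact hx.ge (show x ∈ g.map.hom ⁻¹' {g.map.hom x} from rfl)

instance : toFrameSpace.{u}.Full where
  map_surjective {X Y} h := by
    let l : Y.opens ⟶ X.opens := h.unop.hom.left
    let r : TopCABA.powerset Y.space ⟶ TopCABA.powerset X.space := h.unop.hom.right
    obtain ⟨f, hf⟩ := CompleteLatticeHom.exists_eq_setPreimage
      (show CompleteLatticeHom (Set Y.space) (Set X.space) from r.toCompleteLatticeHom)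
    let l' : Opens Y.space → Opens X.space := l.toFrameHom
    have hl (U : Opens Y.space) : (l' U : Set X.space) = f ⁻¹' U := by
      have hw := DFunLike.congr_fun (congrArg TopFrame.Hom.toFrameHom h.unop.hom.w) U
      exact Eq.trans hw (DFunLike.congr_fun hf (U : Set Y.space))
    have hcont : Continuous f := continuous_def.2 fun U hU =>
      hl ⟨U, hU⟩ ▸ (l' ⟨U, hU⟩).isOpen
    have hcomap : ⇑(Opens.comap ⟨f, hcont⟩) = l' :=
      funext fun U => Opens.ext (hl U).symm
    refine ⟨Hom.mk (TopCat.ofHom ⟨f, hcont⟩) ?_, ?_⟩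
    · change Continuous[Y.opensTop, X.opensTop] (Opens.comap ⟨f, hcont⟩)
      rw [hcomap]
      exact l.continuous
    · refine Quiver.Hom.unop_inj (ObjectProperty.hom_ext _ (CommaMorphism.ext ?_ ?_))
      · exact TopFrame.Hom.ext (DFunLike.ext _ _ fun U => congrFun hcomap U)
      · exact TopCABA.Hom.ext hf.symm

/-- The topology on `X` whose open sets are the elements of a frame of subsets of `X`. -/
abbrev spaceOfFrame {F X : Type u} [Order.Frame F] (φ : FrameHom F (Set X)) :
    TopologicalSpace X where
  IsOpen s := s ∈ Set.range φ
  isOpen_univ := ⟨⊤, map_top φ⟩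
  isOpen_inter := by
    rintro _ _ ⟨a, rfl⟩ ⟨b, rfl⟩
    exact ⟨a ⊓ b, map_inf φ a b⟩
  isOpen_sUnion s hs := by
    choose! g hg using hs
    refine ⟨sSup (g '' s), ?_⟩
    rw [map_sSup, Set.image_image, Set.image_congr hg, Set.image_id']
    rfl

/-- A frame of subsets is isomorphic to the open sets of the space which it determines. -/
noncomputable def isoOpens {F X : Type u} [Order.Frame F] (φ : FrameHom F (Set X))
    (hφ : Function.Injective φ) :
    letI := spaceOfFrame φ
    F ≃o Opens X :=
  letI := spaceOfFrame φ
  { Equiv.ofBijective (fun a => (⟨φ a, a, rfl⟩ : Opens X))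
      ⟨fun a b h => hφ (congrArg (fun U : Opens X => (U : Set X)) h),
        fun U => let ⟨a, ha⟩ := U.isOpen; ⟨a, Opens.ext ha⟩⟩ with
    map_rel_iff' := fun {a b} => by
      change φ a ≤ φ b ↔ a ≤ b
      rw [← inf_eq_left, ← map_inf, hφ.eq_iff, inf_eq_left] }

instance : toFrameSpace.{u}.EssSurj where
  mem_essImage T := by
    obtain ⟨⟨⟨F, B, ψ⟩, hψ⟩⟩ := T
    have hinj : Function.Injective ψ.toFrameHom := @TopFrame.injective_of_mono _ _ ψ hψ
    obtain ⟨X, ⟨e⟩⟩ := B.exists_iso_powerset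
    let φ : FrameHom F.carrier (Set X) := (ψ ≫ TopCABA.toTopFrame.map e.hom).toFrameHom
    have hφ : Function.Injective φ := by
      refine Function.Injective.comp (g := e.hom.toCompleteLatticeHom) ?_ hinj
      refine Function.LeftInverse.injective (g := e.inv.toCompleteLatticeHom) fun b => ?_
      exact DFunLike.congr_fun (congrArg TopCABA.Hom.toCompleteLatticeHom e.hom_inv_id) b
    let _ := spaceOfFrame φ
    let o := isoOpens φ hφ
    let Y : TopTopology :=
      { space := TopCat.of X
        opensTop := .induced o.symm F.top
        isTopological := F.isTopological.induced (o.symm : FrameHom (Opens X) F.carrier) }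
    let l : Y.opens ≅ F := @TopFrame.isoOfOrderIso Y.opens F o.symm ⟨rfl⟩
    exact ⟨Y, ⟨(ObjectProperty.isoMk _ (Comma.isoMk l.symm e
      (TopFrame.Hom.ext (DFunLike.ext _ _ fun _ => rfl)))).op⟩⟩

instance : toFrameSpace.{u}.IsEquivalence where

end TopTopology

namespace TopTopology

/-- The topology on the set of continuous maps out of a topological topology generated by the
preimage maps of open sets. -/
abbrev homTopology (X : TopTopology.{u}) (Y : TopCat.{u}) : TopologicalSpace (X.space ⟶ Y) :=
  ⨅ U : Opens Y, .induced (fun f => Opens.comap f.hom U) X.opensTop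

theorem continuous_comap_hom (X : TopTopology.{u}) {Y : TopCat.{u}} (U : Opens Y) :
    Continuous[X.homTopology Y, X.opensTop] fun f => Opens.comap f.hom U :=
  continuous_iff_le_induced.2 (iInf_le _ U)

theorem continuous_hom_iff (X : TopTopology.{u}) {Y : TopCat.{u}} {Z : Type*}
    [TopologicalSpace Z] {g : Z → (X.space ⟶ Y)} :
    Continuous[_, X.homTopology Y] g ↔
      ∀ U : Opens Y, Continuous[_, X.opensTop] fun z => Opens.comap (g z).hom U := by
  rw [continuous_iInf_rng]
  exact forall_congr' fun U => continuous_induced_rng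

/-- The functor of continuous maps out of a topological topology. -/
def homFunctor (X : TopTopology.{u}) : TopCat.{u} ⥤ TopCat.{u} where
  obj Y := @TopCat.of (X.space ⟶ Y) (X.homTopology Y)
  map {Y Z} g :=
    letI := X.homTopology Y
    letI := X.homTopology Z
    TopCat.ofHom ⟨fun f => f ≫ g,
      X.continuous_hom_iff.2 fun U => X.continuous_comap_hom (Opens.comap g.hom U)⟩

/-- Given a topology on a set of continuous maps, the open sets of the target on which taking
preimages is continuous form a topology. -/
abbrev comapTopology (X : TopTopology.{u}) {Y : TopCat.{u}}
    (t : TopologicalSpace (X.space ⟶ Y)) : TopologicalSpace Y :=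
  letI := X.opensTop
  { IsOpen U := ∃ h : IsOpen[Y.str] U,
      Continuous[t, X.opensTop] fun f => Opens.comap f.hom ⟨U, h⟩
    isOpen_univ := ⟨isOpen_univ, @continuous_const _ _ t X.opensTop ⊤⟩
    isOpen_inter := fun _ _ hU hV =>
      ⟨hU.1.inter hV.1, X.isTopological.inf_comp hU.2 hV.2⟩
    isOpen_sUnion := fun S hS => by
      refine ⟨isOpen_sUnion fun U hU => (hS U hU).1, ?_⟩
      refine (X.isTopological.iSup_comp fun U : S => (hS U U.2).2).congr fun f => ?_
      refine Opens.ext ?_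
      rw [Opens.coe_iSup]
      change ⋃ U : S, f.hom ⁻¹' U = f.hom ⁻¹' ⋃₀ S
      rw [Set.sUnion_eq_iUnion, Set.preimage_iUnion] }

/-- If the topology of `Y` is generated by a family of maps, then the topology on maps into `Y` is
generated by composition with this family. -/
theorem homTopology_eq_iInf (X : TopTopology.{u}) {Y : TopCat.{u}} {J : Type*}
    {Z : J → TopCat.{u}} (p : ∀ j, Y ⟶ Z j) (hY : Y.str = ⨅ j, .induced (p j) (Z j).str) :
    X.homTopology Y = ⨅ j, .induced (fun f => f ≫ p j) (X.homTopology (Z j)) := by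
  apply le_antisymm
  · refine le_iInf fun j => continuous_iff_le_induced.1 ?_
    exact (X.homFunctor.map (p j)).hom.continuous
  · let t : TopologicalSpace (X.space ⟶ Y) :=
      ⨅ j, .induced (fun f => f ≫ p j) (X.homTopology (Z j))
    have hs : X.comapTopology t ≤ Y.str := by
      rw [hY]
      refine le_iInf fun j => continuous_iff_le_induced.1
        ((@continuous_def _ _ (X.comapTopology t) _ _).2 fun U hU => ?_)
      refine ⟨(p j).hom.continuous.isOpen_preimage U hU, ?_⟩
      have h : Continuous[t, X.homTopology (Z j)] fun f => f ≫ p j :=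
        continuous_iff_le_induced.2 (iInf_le _ j)
      exact @Continuous.comp _ _ _ t (X.homTopology (Z j)) X.opensTop _ _
        (X.continuous_comap_hom ⟨U, hU⟩) h
    exact le_iInf fun U => continuous_iff_le_induced.1 (hs U U.isOpen).2

instance (X : TopTopology.{u}) : PreservesLimitsOfSize.{u, u} X.homFunctor where
  preservesLimitsOfShape {J} _ :=
    { preservesLimit {K} :=
        { preserves {c} hc := by
            refine (TopCat.nonempty_isLimit_iff_eq_induced (X.homFunctor.mapCone c) ?_).2 ?_
            · exact isLimitOfPreserves (coyoneda.obj (Opposite.op X.space)) hc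
            · exact X.homTopology_eq_iInf c.π.app (TopCat.induced_of_isLimit c hc) } }

/-- Morphisms of topological topologies act on functors of continuous maps by composition. -/
def homFunctorMap {X Y : TopTopology.{u}} (f : X ⟶ Y) : Y.homFunctor ⟶ X.homFunctor where
  app Z :=
    letI := X.homTopology Z
    letI := Y.homTopology Z
    TopCat.ofHom ⟨fun g => f.map ≫ g, X.continuous_hom_iff.2 fun U =>
      @Continuous.comp _ _ _ _ Y.opensTop X.opensTop _ _ f.continuous_comap
        (Y.continuous_comap_hom U)⟩

/-- The functor from topological topologies to continuous endofunctors. -/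
def toContinuousEndofunctor : TopTopology.{u}ᵒᵖ ⥤ ContinuousEndofunctor.{u} where
  obj X := ⟨X.unop.homFunctor, inferInstance⟩
  map f := ObjectProperty.homMk (homFunctorMap f.unop)

end TopTopology

namespace Sierpinski

/-- Continuous maps to the Sierpiński space are the same as open sets. -/
def homEquiv (X : TopCat.{u}) : (X ⟶ TopCat.of Sierpinski.{u}) ≃ Opens X where
  toFun f := Opens.comap f.hom openTrue
  invFun U := TopCat.ofHom ⟨fun x => ⟨x ∈ U⟩, continuous_uliftUp.comp (continuous_Prop.2 U.isOpen)⟩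
  left_inv _ := rfl
  right_inv _ := rfl

theorem eq_bot_or_eq_openTrue_or_eq_top (U : Opens Sierpinski.{u}) :
    U = ⊥ ∨ U = openTrue ∨ U = ⊤ := by
  have hext {V : Opens Sierpinski.{u}} (h : ∀ p, ⟨p⟩ ∈ U ↔ ⟨p⟩ ∈ V) : U = V :=
    Opens.ext (Set.ext fun p => h p.down)
  have htrue : (⟨True⟩ : Sierpinski.{u}) ∈ openTrue := trivial
  have hfalse : (⟨False⟩ : Sierpinski.{u}) ∉ openTrue := id
  by_cases h0 : ⟨False⟩ ∈ U
  · refine .inr (.inr (hext fun p => ?_))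
    by_cases hp : p <;> simp [hp, h0, mem_of_mem h0]
  · by_cases h1 : ⟨True⟩ ∈ U
    · refine .inr (.inl (hext fun p => ?_))
      by_cases hp : p <;> simp [hp, h0, h1, htrue, hfalse]
    · refine .inl (hext fun p => ?_)
      by_cases hp : p <;> simp [hp, h0, h1]

end Sierpinski

namespace TopTopology

theorem isInducing_homEquiv (X : TopTopology.{u}) :
    @IsInducing _ _ (X.homTopology (TopCat.of Sierpinski.{u})) X.opensTop
      (Sierpinski.homEquiv X.space) := by
  let _ := X.opensTop
  refine @IsInducing.mk _ _ (_) _ _ (le_antisymm (iInf_le _ Sierpinski.openTrue)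
    (le_iInf fun U => ?_))
  obtain rfl | rfl | rfl := Sierpinski.eq_bot_or_eq_openTrue_or_eq_top U
  · exact (le_top.trans_eq (@induced_const _ _ X.opensTop ⊥).symm)
  · exact le_rfl
  · exact (le_top.trans_eq (@induced_const _ _ X.opensTop ⊤).symm)

theorem continuous_homEquiv_symm (X : TopTopology.{u}) :
    Continuous[X.opensTop, X.homTopology (TopCat.of Sierpinski.{u})]
      (Sierpinski.homEquiv X.space).symm :=
  let _ := X.opensTop
  let _ := X.homTopology (TopCat.of Sierpinski.{u})
  X.isInducing_homEquiv.continuous_iff.2 <|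
    continuous_id.congr fun U => ((Sierpinski.homEquiv X.space).apply_symm_apply U).symm

instance : toContinuousEndofunctor.{u}.Faithful where
  map_injective {X Y f g} h := by
    have h' : homFunctorMap f.unop = homFunctorMap g.unop := congrArg (fun k => k.hom) h
    have := ConcreteCategory.congr_hom (NatTrans.congr_app h' X.unop.space) (𝟙 X.unop.space)
    refine Quiver.Hom.unop_inj (Hom.ext ?_)
    simpa [homFunctorMap] using! this

instance : toContinuousEndofunctor.{u}.Full where
  map_surjective {X Y} h := by
    let α : X.unop.homFunctor ⟶ Y.unop.homFunctor := h.hom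
    let f : Y.unop.space ⟶ X.unop.space := α.app X.unop.space (𝟙 X.unop.space)
    have hα (Z : TopCat.{u}) (g : X.unop.space ⟶ Z) : α.app Z g = f ≫ g := by
      have h := ConcreteCategory.congr_hom (α.naturality g) (𝟙 X.unop.space)
      refine Eq.trans ?_ h
      exact congrArg (α.app Z) (Category.id_comp g).symm
    refine ⟨Quiver.Hom.op (Hom.mk f ?_), ?_⟩
    · have h : ⇑(Opens.comap f.hom) = Sierpinski.homEquiv Y.unop.space ∘
          α.app (TopCat.of Sierpinski.{u}) ∘ (Sierpinski.homEquiv X.unop.space).symm := by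
        funext U
        simp only [Function.comp]
        rw [hα]
        rfl
      rw [h]
      let _ := X.unop.opensTop
      let _ := Y.unop.opensTop
      let _ := Y.unop.homTopology (TopCat.of Sierpinski.{u})
      exact Y.unop.isInducing_homEquiv.continuous.comp
        ((α.app (TopCat.of Sierpinski.{u})).hom.continuous.comp X.unop.continuous_homEquiv_symm)
    · refine ObjectProperty.hom_ext _ (NatTrans.ext (funext fun Z => ?_))
      exact TopCat.hom_ext (ContinuousMap.ext fun g => (hα Z g).symm)

end TopTopology

namespace TopCat

theorem subobject_le_of_image_eq {X : TopCat.{u}} {P Q : Subobject X}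
    (hr : Set.range P.arrow ⊆ Set.range Q.arrow)
    (ho : ∀ U : Set (Q : TopCat.{u}), IsOpen U →
      ∃ V : Set (P : TopCat.{u}), IsOpen V ∧ P.arrow '' V = Q.arrow '' U) : P ≤ Q := by
  have hP : Function.Injective P.arrow := (TopCat.mono_iff_injective _).1 inferInstance
  have hQ : Function.Injective Q.arrow := (TopCat.mono_iff_injective _).1 inferInstance
  choose f hf using fun p => hr (Set.mem_range_self p)
  have hcont : Continuous f := continuous_def.2 fun U hU => by
    obtain ⟨V, hV, h⟩ := ho U hU
    convert hV
    ext p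
    rw [Set.mem_preimage, ← hQ.mem_set_image, ← h, hf, hP.mem_set_image]
  refine Subobject.le_of_comm (TopCat.ofHom ⟨f, hcont⟩) ?_
  exact TopCat.hom_ext (ContinuousMap.ext hf)

instance : WellPowered.{u} TopCat.{u} where
  subobject_small X := by
    refine small_of_injective (β := Set X × Set (Set X)) (f := fun P =>
      (Set.range P.arrow, {s | ∃ U : Set (P : TopCat.{u}), IsOpen U ∧ P.arrow '' U = s}))
      fun P Q h => ?_
    obtain ⟨hr, ho⟩ := Prod.ext_iff.1 h
    exact le_antisymm
      (subobject_le_of_image_eq hr.subset fun U hU => ho.ge ⟨U, hU, rfl⟩)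
      (subobject_le_of_image_eq hr.superset fun U hU => ho.le ⟨U, hU, rfl⟩)

/-- Continuous maps into an indiscrete space are arbitrary maps. -/
def toIndiscrete {X : TopCat.{u}} {A : Type u} (f : X → A) : X ⟶ trivial.obj A :=
  @ofHom _ _ _ ⊤ (@ContinuousMap.mk _ _ _ ⊤ f continuous_top)

theorem isCoseparator_indiscrete : IsCoseparator (trivial.obj (ULift.{u} Prop)) := by
  refine isCoseparator_def _ |>.2 fun X Y f g h => ?_
  refine TopCat.hom_ext (ContinuousMap.ext fun x => ?_)
  have h' := ConcreteCategory.congr_hom (h (toIndiscrete fun y => ⟨y = f x⟩)) x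
  exact ((congrArg ULift.down h').mp (rfl : f x = f x)).symm

theorem isCorepresentable_of_preservesLimits (G : TopCat.{u} ⥤ Type u)
    [PreservesLimitsOfSize.{u, u} G] : G.IsCorepresentable := by
  have : G.IsRightAdjoint :=
    isRightAdjoint_of_preservesLimits_of_isCoseparating isCoseparator_indiscrete G
  have h := ((Adjunction.ofIsRightAdjoint G).corepresentableBy PUnit).isCorepresentable
  have e : G ⋙ coyoneda.obj (Opposite.op PUnit.{u + 1}) ≅ G :=
    Functor.isoWhiskerLeft G Coyoneda.punitIso ≪≫ G.rightUnitor
  exact .mk' ((G ⋙ coyoneda.obj (Opposite.op PUnit.{u + 1})).coreprW ≪≫ e)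

end TopCat

namespace ContinuousEndofunctor

open TopCat

variable {G : TopCat.{u} ⥤ TopCat.{u}} {X : TopCat.{u}}
  (e : coyoneda.obj (Opposite.op X) ≅ G ⋙ forget TopCat.{u})

/-- The topology on continuous maps out of `X` determined by an endofunctor of topological spaces
whose underlying functor is corepresented by `X`. -/
abbrev repTopology (Y : TopCat.{u}) : TopologicalSpace (X ⟶ Y) :=
  .induced (e.hom.app Y) (G.obj Y).str

theorem map_hom_app {Y Z : TopCat.{u}} (g : Y ⟶ Z) (f : X ⟶ Y) :
    G.map g (e.hom.app Y f) = e.hom.app Z (f ≫ g) :=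
  (ConcreteCategory.congr_hom (e.hom.naturality g) f).symm

theorem continuous_comp {Y Z : TopCat.{u}} (g : Y ⟶ Z) :
    Continuous[repTopology e Y, repTopology e Z] fun f => f ≫ g := by
  let _ := repTopology e Y
  refine continuous_induced_rng.2 (((G.map g).hom.continuous.comp continuous_induced_dom).congr ?_)
  exact map_hom_app e g

theorem repTopology_of_isLimit {J : Type*} [Category* J]
    [PreservesLimitsOfShape J G] {K : J ⥤ TopCat.{u}} {c : Cone K} (hc : IsLimit c) :
    repTopology e c.pt = ⨅ j, .induced (fun f => f ≫ c.π.app j) (repTopology e (K.obj j)) := by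
  have h := induced_of_isLimit _ (isLimitOfPreserves G hc)
  refine (congrArg (TopologicalSpace.induced (e.hom.app c.pt)) h).trans ?_
  rw [induced_iInf]
  refine iInf_congr fun j => ?_
  rw [induced_compose, induced_compose]
  exact congrArg (fun k => TopologicalSpace.induced k _) (funext fun f => map_hom_app e _ f)

variable [PreservesLimitsOfSize.{u, u} G]

theorem continuous_piLift {I : Type u} {Y : I → TopCat.{u}} {Z : Type*} [TopologicalSpace Z]
    {h : ∀ i, Z → (X ⟶ Y i)} (hh : ∀ i, Continuous[_, repTopology e (Y i)] (h i)) :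
    Continuous[_, repTopology e (TopCat.of (∀ i, Y i))]
      fun z => TopCat.ofHom (.pi fun i => (h i z).hom) := by
  rw [show repTopology e (TopCat.of (∀ i, Y i)) = _ from
    repTopology_of_isLimit e (piFanIsLimit Y)]
  exact continuous_iInf_rng.2 fun i => continuous_induced_rng.2 (hh i.as)

theorem repTopology_pi {I : Type u} (Y : I → TopCat.{u}) :
    repTopology e (TopCat.of (∀ i, Y i)) =
      ⨅ i, .induced (fun f => f ≫ piπ Y i) (repTopology e (Y i)) :=
  (repTopology_of_isLimit e (piFanIsLimit Y)).trans <|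
    Equiv.iInf_congr discreteEquiv fun _ => rfl

open Classical in
/-- The value which a family takes at cofinitely many indices, if there is one. -/
noncomputable def cofiniteValue {A : Type u} (s : ULift.{u} ℕ → A) : A :=
  if h : ∃ a, ∀ᶠ n in Filter.cofinite, s n = a then h.choose else s ⟨0⟩

theorem cofiniteValue_eq {A : Type u} {s : ULift.{u} ℕ → A} {a : A}
    (h : ∀ᶠ n in Filter.cofinite, s n = a) : cofiniteValue s = a := by
  have h' : ∃ a, ∀ᶠ n in Filter.cofinite, s n = a := ⟨a, h⟩
  obtain ⟨n, h₁, h₂⟩ := (h'.choose_spec.and h).exists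
  rw [cofiniteValue, dif_pos h', ← h₁, h₂]

theorem repTopology_indiscrete (A : Type u) : repTopology e (trivial.obj A) = ⊤ := by
  let _ := repTopology e (trivial.obj A)
  have hc : Continuous fun s : ULift.{u} ℕ → (X ⟶ trivial.obj A) =>
      (toIndiscrete fun x => cofiniteValue fun n => s n x : X ⟶ trivial.obj A) :=
    @Continuous.comp _ _ _ _ (repTopology e _) _ _ _
      (continuous_comp e (toIndiscrete (X := TopCat.of (ULift.{u} ℕ → trivial.obj A))
        (A := A) cofiniteValue))
      (continuous_piLift e (Y := fun _ : ULift.{u} ℕ => trivial.obj A) continuous_apply)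
  have hval {s : ULift.{u} ℕ → (X ⟶ trivial.obj A)} {f : X ⟶ trivial.obj A}
      (h : ∀ᶠ n in Filter.cofinite, s n = f) :
      (toIndiscrete fun x => cofiniteValue fun n => s n x : X ⟶ trivial.obj A) = f :=
    TopCat.hom_ext (ContinuousMap.ext fun x => cofiniteValue_eq (h.mono fun n hn => by rw [hn]))
  refine top_unique fun W hW => (isOpen_top_iff W).2 ?_
  rcases W.eq_empty_or_nonempty with h | ⟨f, hf⟩
  · exact .inl h
  refine .inr (Set.eq_univ_of_forall fun g => ?_)
  obtain ⟨I, v, hv, hsub⟩ := isOpen_pi_iff.1 (hW.preimage hc) (fun _ => f) <| by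
    rw [Set.mem_preimage, hval (f := f) (.of_forall fun _ => rfl)]
    exact hf
  classical
  have h := hsub (show (fun n => if n ∈ I then f else g) ∈ (I : Set (ULift.{u} ℕ)).pi v from
    fun n hn => by
      change (if n ∈ I then f else g) ∈ v n
      rw [if_pos (Finset.mem_coe.1 hn)]
      exact (hv n hn).2)
  rwa [Set.mem_preimage, hval (f := g)] at h
  exact (Filter.eventually_cofinite.2 (I.finite_toSet.subset fun n hn => by
    by_contra h
    exact hn (if_neg h)))

/-- Every space is the pullback of the indiscrete space on its points and a power of the
Sierpiński space, over a power of the indiscrete space of truth values. -/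
theorem exists_isLimit_pullbackCone (Y : TopCat.{u}) :
    let S := fun _ : Opens Y => TopCat.of Sierpinski.{u}
    let f : trivial.obj Y ⟶ trivial.obj (Opens Y → Sierpinski.{u}) :=
      toIndiscrete fun (y : Y) U => ⟨y ∈ U⟩
    let g : TopCat.of (∀ U, S U) ⟶ trivial.obj (Opens Y → Sierpinski.{u}) := toIndiscrete id
    let l : Y ⟶ trivial.obj Y := toIndiscrete id
    let r : Y ⟶ TopCat.of (∀ U, S U) :=
      TopCat.ofHom (.pi fun U => ((Sierpinski.homEquiv Y).symm U).hom)
    ∃ w : l ≫ f = r ≫ g, Nonempty (IsLimit (PullbackCone.mk l r w)) := by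
  intro S f g l r
  refine ⟨rfl, ⟨PullbackCone.IsLimit.mk _ (fun s => TopCat.ofHom ⟨fun z => s.fst z, ?_⟩)
    (fun s => rfl) (fun s => ?_) (fun s m hm _ => ?_)⟩⟩
  · refine continuous_def.2 fun U hU => ?_
    have h : s.fst ⁻¹' U = {z | (s.snd z ⟨U, hU⟩).down} := by
      ext z
      have hz := congrFun (ConcreteCategory.congr_hom s.condition z) ⟨U, hU⟩
      exact (congrArg ULift.down hz).to_iff
    exact h ▸ continuous_Prop.1
      (continuous_uliftDown.comp ((continuous_apply _).comp s.snd.hom.continuous))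
  · exact TopCat.hom_ext (ContinuousMap.ext fun z => ConcreteCategory.congr_hom s.condition z)
  · exact TopCat.hom_ext (ContinuousMap.ext fun z => ConcreteCategory.congr_hom hm z)

theorem repTopology_eq_iInf (Y : TopCat.{u}) :
    repTopology e Y = ⨅ U : Opens Y, .induced (fun f => f ≫ (Sierpinski.homEquiv Y).symm U)
      (repTopology e (TopCat.of Sierpinski.{u})) := by
  refine le_antisymm
    (le_iInf fun U => continuous_iff_le_induced.1 (continuous_comp e _)) ?_
  have := PreservesLimitsOfSize.preservesFiniteLimits G
  obtain ⟨w, ⟨h⟩⟩ := exists_isLimit_pullbackCone Y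
  rw [show repTopology e Y = _ from repTopology_of_isLimit e h]
  have hind {A : Type u} (k : Y ⟶ trivial.obj A) (t : TopologicalSpace (X ⟶ Y)) :
      t ≤ .induced (fun f => f ≫ k) (repTopology e (trivial.obj A)) := by
    rw [repTopology_indiscrete, induced_top]
    exact le_top
  have hpow : ⨅ U : Opens Y, TopologicalSpace.induced (fun f => f ≫ (Sierpinski.homEquiv Y).symm U)
        (repTopology e (TopCat.of Sierpinski.{u})) ≤
      TopologicalSpace.induced (fun f : X ⟶ Y => f ≫
          (TopCat.ofHom (.pi fun U => ((Sierpinski.homEquiv Y).symm U).hom) :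
            Y ⟶ TopCat.of (Opens Y → TopCat.of Sierpinski.{u})))
        (repTopology e (TopCat.of (Opens Y → TopCat.of Sierpinski.{u}))) := by
    rw [repTopology_pi e fun _ : Opens Y => TopCat.of Sierpinski.{u}, induced_iInf]
    refine le_iInf fun U => (iInf_le _ U).trans_eq ?_
    refine Eq.trans ?_ induced_compose.symm
    exact congrArg (fun k => TopologicalSpace.induced k _) (funext fun f => rfl)
  refine le_iInf fun j => ?_
  rcases j with _ | _ | _
  · exact hind (A := Opens Y → Sierpinski.{u}) _ _
  · exact hind (A := Y) _ _
  · exact hpow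

/-- The topology on the open sets of `X` determined by an endofunctor corepresented by `X`. -/
abbrev opensTopology : TopologicalSpace (Opens X) :=
  .induced (Sierpinski.homEquiv X).symm (repTopology e (TopCat.of Sierpinski.{u}))

theorem isTopologicalFrame_opensTopology : @IsTopologicalFrame (Opens X) _ (opensTopology e) := by
  let S := TopCat.of Sierpinski.{u}
  let t := opensTopology e
  have hpi (I : Type u) : Continuous[_, repTopology e (TopCat.of (I → S))]
      fun a : I → Opens X => TopCat.ofHom (.pi fun i => ((Sierpinski.homEquiv X).symm (a i)).hom) :=
    continuous_piLift e (Y := fun _ => S)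
      fun i => @Continuous.comp _ _ _ _ t (repTopology e S) _ _ continuous_induced_dom
        (continuous_apply i)
  refine ⟨fun I => ?_, fun J _ => ?_⟩
  · let join : TopCat.of (I → S) ⟶ S := TopCat.ofHom
      ⟨fun p => ⟨∃ i, (p i).down⟩, continuous_uliftUp.comp (continuous_Prop.2 (by
        rw [Set.ofPred_exists]
        exact isOpen_iUnion fun i =>
          continuous_Prop.1 (continuous_uliftDown.comp (continuous_apply i))))⟩
    refine continuous_induced_rng.2 ?_
    have h := @Continuous.comp _ _ _ _ (repTopology e _) (repTopology e _) _ _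
      (continuous_comp e join) (hpi I)
    convert h using 1
    funext a
    refine TopCat.hom_ext (ContinuousMap.ext fun x => congrArg ULift.up (propext ?_))
    exact Opens.mem_iSup
  · let meet : TopCat.of (J → S) ⟶ S := TopCat.ofHom
      ⟨fun p => ⟨∀ j, (p j).down⟩, continuous_uliftUp.comp (continuous_Prop.2 (by
        rw [Set.ofPred_forall]
        exact isOpen_iInter_of_finite fun i =>
          continuous_Prop.1 (continuous_uliftDown.comp (continuous_apply i))))⟩
    refine continuous_induced_rng.2 ?_
    have h := @Continuous.comp _ _ _ _ (repTopology e _) (repTopology e _) _ _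
      (continuous_comp e meet) (hpi J)
    convert h using 1
    funext a
    refine TopCat.hom_ext (ContinuousMap.ext fun x => congrArg ULift.up (propext ?_))
    change x ∈ ((⨅ j, a j : Opens X) : Set X) ↔ ∀ j, x ∈ a j
    rw [Opens.coe_iInf]
    simp

/-- The topological topology determined by an endofunctor corepresented by `X`. -/
abbrev toTopTopology : TopTopology.{u} where
  space := X
  opensTop := opensTopology e
  isTopological := isTopologicalFrame_opensTopology e

theorem homTopology_toTopTopology (Y : TopCat.{u}) :
    (toTopTopology e).homTopology Y = repTopology e Y := by
  rw [repTopology_eq_iInf]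
  exact iInf_congr fun U => induced_compose

/-- The functor of continuous maps out of the topological topology determined by a corepresented
endofunctor is isomorphic to this endofunctor. -/
noncomputable def homFunctorIso : (toTopTopology e).homFunctor ≅ G :=
  NatIso.ofComponents
    (fun Y => TopCat.isoOfHomeo <|
      @Equiv.toHomeomorphOfIsInducing _ _ ((toTopTopology e).homTopology Y) _
        (e.app Y).toEquiv (@IsInducing.mk _ _ (_) _ _ (homTopology_toTopTopology e Y)))
    (fun g => TopCat.hom_ext (ContinuousMap.ext fun f => (map_hom_app e g f).symm))

end ContinuousEndofunctor

namespace TopTopology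

instance : toContinuousEndofunctor.{u}.EssSurj where
  mem_essImage G := by
    obtain ⟨G, hG⟩ := G
    have := TopCat.isCorepresentable_of_preservesLimits (G ⋙ forget TopCat.{u})
    exact ⟨_, ⟨ObjectProperty.isoMk _
      (ContinuousEndofunctor.homFunctorIso (G ⋙ forget TopCat.{u}).coreprW)⟩⟩

instance : toContinuousEndofunctor.{u}.IsEquivalence where

end TopTopology

theorem theorem9p8 :
    Nonempty (ContinuousEndofunctor.{u} ≌ TopTopology.{u}ᵒᵖ) ∧
    (∀ B : TopCABA.{u}, ∃ X : Type u, Nonempty (B ≅ TopCABA.powerset X)) ∧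
    TopTopology.toFrameSpace.{u}.IsEquivalence :=
  ⟨⟨TopTopology.toContinuousEndofunctor.asEquivalence.symm⟩, TopCABA.exists_iso_powerset,
    inferInstance⟩
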